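/- \textbf{Robot construction problems.} Let $\mathcal A$ (grippers), $\mathcal B$ (blocks), $\mathcal S$ (ground surfaces) be sets, and let $\mathcal L=\mathcal B\sqcup\mathcal S$ be the locations. Each $l\in\mathcal L$ has a positive size $n_l$ and unit spaces $1,\dots,n_l$; the unit $u$ of a surface $s$ lies $o_s+u$ units to the right of a fixed origin ($o_s\in\mathbb Z$; $o_s=0$ for a single table). A state is a set of fluents $\mathit{holding}(a,b)$ (gripper $a$ holds block $b$) and $\mathit{on}(b,l,u,v)$ (unit $v$ of $b$ is on unit $u$ of $l$). A problem consists of these data, an initial state whose unit spaces are in range, goal conditions (a set of pairs of finite lists of fluents $(P,N)$, each forbidding the final states in which all of $P$ and none of $N$ holds), and, for bridges, two regions $\mathit{Left},\mathit{Right}\subseteq\mathcal S\times\mathbb N$ of ground units. In a state, $b$ rests on $l$ if $\mathit{on}(b,l,u,v)$ for some $u,v$; $b$ is supported by $l$ if there is a nonempty chain of blocks from $b$ to $l$ each resting on the next; $b$ is grounded if it is supported by a surface, and carried if it is held or supported by a held block. Connectedness of blocks is the transitive closure of "$x$ rests on $y$ or $y$ rests on $x$". The global positions $\mathit{above}(h,b,v,x)$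 (unit $v$ of $b$ is at height $h$, $x$ units to the right of the origin) form the least relation such that: $\mathit{on}(b,s,u,v)$ with $s\in\mathcal S$ gives $\mathit{above}(1,b,v,o_s+u)$; $\mathit{above}(h,b',u,x)$ and $\mathit{on}(b,b',u,v)$ give $\mathit{above}(h+1,b,v,x)$; $\mathit{above}(h,b,v,x)$ gives $\mathit{above}(h,b,v+1,x+1)$ if $v<n_b$ and $\mathit{above}(h,b,v-1,x-1)$ if $v>1$. \textbf{Plans.} Call a set of contacts ramification closed if $\mathit{on}(b,l,u,v)$ implies $\mathit{on}(b,l,u\pm i,v\pm i)$ for all $i\ge1$ for which these units exist; $\mathit{above}(h+1,b,v,x)$ and $\mathit{above}(h,b',u,x)$ imply $\mathit{on}(b,b',u,v)$; and $\mathit{above}(1,b,v,o_s+u)$ with $1\le u\le n_s$ implies $\mathit{on}(b,s,u,v)$. A state is valid if a gripper holds at most one block and a block is held by at most one gripper; a held block rests on nothing; every block is held or rests on something; each block unit is on at most one unit and each unit has at most one block unit on it; each block unit has at most one global position and distinct block units have distinct global positions; and no block is both carried and grounded. A plan of makespan $m$ consists of states at times $0,\dots,m$ and, for each $t<m$, at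 most one action of each gripper, all performed concurrently: pick a block $b$ (precondition: the gripper is empty and no gripper holds $b$), or place the held block $b$ with its unit $v$ on unit $u$ of $l$. It is required that the first state is the initial one, all states are valid and ramification closed, the last one meets the goal conditions, and each step has the following effects. Afterwards a gripper holds exactly what it picked, or what it held and did not place. Placing establishes its contact. Call a block moved if it is picked or supported by a picked block; the contacts of a block that is not moved persist, and so do the contacts of a block that is not picked with a moved block under it. Every contact after the step lies in every ramification closed set that contains the contacts present both before and after the step and those established by placing. \textbf{Desired properties.} Supportedness: at no time is a block supported by itself. Stability, for a given (arbitrary) notion of stable structure: at each time the structure of the grounded blocks (their contacts) is stable, and so is that of the carried blocks (who holds what, and the contacts of carried blocks) whenever some block rests on a held block. Connectedness (only for bridges): in the last state some block lying on a unit of $\mathit{Left}$ is connected to some block lying on a unit of $\mathit{Right}$. \textbf{The program.} Programs are sets of ground disjunctive rules with external atoms and count aggregates; an answer set is an inclusion-minimal model of the Faber–Leone–Pfeifer reduct. Let $T\ge1$. Fluents are time-stamped by $t\in\{0,\dots,T\}$, and the action atoms $\mathit{pick}(a,b,t)$, $\mathit{place}(a,l,t)$, $\mathit{placeOn}(a,b,l,u,v,t)$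 by $t\in\{0,\dots,T-1\}$. The program $\Pi$ consists of: facts for the initial state; constraints for the goal at $T$; free choice of actions ($p\vee \bar p$ with an auxiliary atom $\bar p$), where $\mathit{placeOn}(a,b,l,u,v,t)$ is chosen only if $\mathit{place}(a,l,t)$ and $\mathit{holding}(a,b,t)$ hold and $u,v$ are in range, exactly one such atom is required for each $\mathit{place}(a,l,t)$, and a gripper places at no more than one location at a time; the preconditions as constraints; the effects $\mathit{holding}(a,b,t+1)\leftarrow\mathit{pick}(a,b,t)$, $\mathit{on}(b,l,u,v,t+1)\leftarrow\mathit{placeOn}(a,b,l,u,v,t)$ and $\leftarrow\mathit{place}(a,l,t),\mathit{holding}(a,b,t+1)$; inertia, namely the choice $f(t+1)\vee\overline{f(t+1)}\leftarrow f(t)$ for every fluent $f$, with a recursive definition of $\mathit{moved}$ and constraints against loss of the contacts that must persist; and the validity conditions on states as constraints. Let $\Gamma$ be a Boolean-valued stability checker. The program $\Pi'$ is $\Pi$ together with, for all $t\le T$: (i) $\mathit{onAux}(b,l,t)\leftarrow\mathit{on}(b,l,u,v,t)$; $\mathit{supported}(b,l,t)\leftarrow\mathit{onAux}(b,l,t)$;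 $\mathit{supported}(b,l,t)\leftarrow\mathit{onAux}(b,l',t),\mathit{supported}(l',l,t)$ ($b\ne l'$); $\leftarrow\mathit{supported}(b,b,t)$; (ii) the four rules defining $\mathit{above}$ and the ramification rules, i.e. the implications listed above written as rules at time $t$; (iii) $\leftarrow\mathit{not}\ \&\mathit{stable}[\mathit{on},t]()$ and $\leftarrow\mathit{holding}(a,b,t),\mathit{onAux}(b',b,t),\mathit{not}\ \&\mathit{hStable}[\mathit{holding},\mathit{on},t]()$, where the two external atoms apply $\Gamma$ to the structure of the grounded, respectively of the carried, blocks at time $t$; (iv) for bridges only, the recursive definition of $\mathit{connected}$, the rules $\mathit{side}(x,\sigma,t)\leftarrow\mathit{on}(x,s,u,v,t)$ for $(s,u)$ in the region $\sigma\in\{\mathit{Left},\mathit{Right}\}$, and $\leftarrow\#\mathrm{count}\{x,y:\mathit{connected}(x,y,T),\mathit{side}(x,\mathit{Left},T),\mathit{side}(y,\mathit{Right},T)\}=0$. \textbf{Proposition (completeness).} Suppose that $\Gamma$ is correct, i.e. $\Gamma$ returns True on a structure if and only if the structure is stable. Then for every plan of makespan $m\le T-1$ that satisfies supportedness, stability and,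 for bridges, connectedness, there is an answer set of $\Pi'$ that characterizes it: its action atoms are exactly the actions of the plan (none at times $t\ge m$), and for every $t\le T$ its fluents at time $t$ are exactly those of the plan's state at time $\min(t,m)$. -/

import Mathlib

/-! ### Answer set programs with external atoms -/

/-- A ground body atom: an ordinary atom, or an atom whose truth value is computed from the
whole interpretation by an oracle (external atoms and aggregates). -/
inductive BodyAtom (α : Type*) where
  | atom (p : α)
  | ext (g : Set α → Prop)

/-- Truth of a body atom in an interpretation. -/
def BodyAtom.Holds {α : Type*} (I : Set α) : BodyAtom α → Prop
  | .atom p => p ∈ I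
  | .ext g => g I

/-- The aggregate `#count {i : cond i} ⋈ n`, where the comparison `⋈ n` is the predicate `cmp`. -/
def BodyAtom.count {α ι : Type*} (cond : ι → List α) (cmp : ℕ∞ → Prop) : BodyAtom α :=
  .ext fun I => cmp {i | ∀ p ∈ cond i, p ∈ I}.encard

/-- A ground disjunctive rule `⋁ head ← pos, not neg`. An empty head is a constraint, an empty
body a (disjunctive) fact. -/
structure Rule (α : Type*) where
  head : List α
  pos : List (BodyAtom α)
  neg : List (BodyAtom α)

/-- The body of the rule is true in `I`. -/
def Rule.BodyHolds {α : Type*} (r : Rule α) (I : Set α) : Prop :=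
  (∀ β ∈ r.pos, β.Holds I) ∧ ∀ β ∈ r.neg, ¬ β.Holds I

/-- `I` satisfies every rule of the ground program. -/
def IsModel {α : Type*} (prog : Set (Rule α)) (I : Set α) : Prop :=
  ∀ r ∈ prog, r.BodyHolds I → ∃ p ∈ r.head, p ∈ I

/-- The reduct (Faber–Leone–Pfeifer) of a program: the rules whose body is true in `I`. -/
def reduct {α : Type*} (prog : Set (Rule α)) (I : Set α) : Set (Rule α) :=
  {r ∈ prog | r.BodyHolds I}

/-- `I` is an answer set: a subset-minimal model of the reduct with respect to `I`. -/
def IsAnswerSet {α : Type*} (prog : Set (Rule α)) (I : Set α) : Prop :=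
  Minimal (IsModel (reduct prog I)) I

/-! ### The robot construction world

`A` is the set of grippers, `B` the set of blocks, `S` the set of ground surfaces. The locations
are `B ⊕ S`. -/

/-- The fluents: gripper `a` holds block `b`; unit `v` of block `b` is on unit `u` of `l`. -/
inductive Fluent (A B S : Type*) where
  | holding (a : A) (b : B)
  | on (b : B) (l : B ⊕ S) (u v : ℕ)

/-- The two sides of a bridge. -/
inductive Side where
  | left
  | right

/-- A robot construction problem. Location `l` has the unit spaces `1, …, size l`. The unit `u` of
the surface `s` lies `offset s + u` units to the right of the global origin (so `offset s = 0` for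
a single table). Each element `(pos, neg)` of `goal` forbids the final states in which all
fluents in `pos` hold and none of those in `neg` does. For bridges, `bridge` gives the ground
regions of the two sides, as sets of pairs (surface, unit). -/
structure Problem (A B S : Type*) where
  size : B ⊕ S → ℕ
  size_pos : ∀ l, 0 < size l
  offset : S → ℤ
  init : Set (Fluent A B S)
  init_range : ∀ b l u v, Fluent.on b l u v ∈ init →
    (1 ≤ u ∧ u ≤ size l) ∧ (1 ≤ v ∧ v ≤ size (.inl b))
  goal : Set (List (Fluent A B S) × List (Fluent A B S))
  bridge : Option (Side → Set (S × ℕ))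

section States

variable {A B S : Type*}

/-- The block `b` is (directly) on the location `l`. -/
def RestsOn (F : Set (Fluent A B S)) (b : B) (l : B ⊕ S) : Prop :=
  ∃ u v, Fluent.on b l u v ∈ F

/-- The block `b` is directly or indirectly supported by the location `l`. -/
def Supported (F : Set (Fluent A B S)) (b : B) (l : B ⊕ S) : Prop :=
  Relation.TransGen (fun x y => ∃ c, x = Sum.inl c ∧ RestsOn F c y) (Sum.inl b) l

/-- The block `b` is supported by the ground. -/
def Grounded (F : Set (Fluent A B S)) (b : B) : Prop :=
  ∃ s, Supported F b (.inr s)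

/-- The block `b` is held by a gripper or supported by a held block. -/
def Carried (F : Set (Fluent A B S)) (b : B) : Prop :=
  ∃ a c, Fluent.holding a c ∈ F ∧ (b = c ∨ Supported F b (.inl c))

/-- The blocks `x` and `y` are linked by a chain of blocks in which any two successive ones
touch, one being on the other. -/
def Connected (F : Set (Fluent A B S)) : B → B → Prop :=
  Relation.TransGen fun x y => RestsOn F x (.inl y) ∨ RestsOn F y (.inl x)

/-- `GlobalPos P F h b v x`: in the state `F`, the unit `v` of block `b` is `h` units high above
the ground and `x` units to the right of the origin. -/
inductive GlobalPos (P : Problem A B S) (F : Set (Fluent A B S)) : ℕ → B → ℕ → ℤ → Prop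
  | ground {b : B} {s : S} {u v : ℕ} (h_on : Fluent.on b (.inr s) u v ∈ F) :
      GlobalPos P F 1 b v (P.offset s + u)
  | up {h : ℕ} {b c : B} {u v : ℕ} {x : ℤ} (hc : GlobalPos P F h c u x)
      (h_on : Fluent.on b (.inl c) u v ∈ F) : GlobalPos P F (h + 1) b v x
  | right {h : ℕ} {b : B} {v : ℕ} {x : ℤ} (hb : GlobalPos P F h b v x)
      (hv : v < P.size (.inl b)) : GlobalPos P F h b (v + 1) (x + 1)
  | left {h : ℕ} {b : B} {v : ℕ} {x : ℤ} (hb : GlobalPos P F h b v x)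
      (hv : 1 < v) : GlobalPos P F h b (v - 1) (x - 1)

/-- The contacts recorded in `F` are closed under ramifications: a block lying on a location
occupies all units of it that its length reaches, and it lies on every block and every surface
directly beneath it. -/
structure RamificationClosed (P : Problem A B S) (F : Set (Fluent A B S)) : Prop where
  right : ∀ b l u v i, 1 ≤ i → v + i ≤ P.size (.inl b) → u + i ≤ P.size l →
    Fluent.on b l u v ∈ F → Fluent.on b l (u + i) (v + i) ∈ F
  left : ∀ b l u v j, 1 ≤ j → 1 ≤ v → 1 ≤ u →
    Fluent.on b l (u + j) (v + j) ∈ F → Fluent.on b l u v ∈ F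
  beneath : ∀ h b c u v x, GlobalPos P F (h + 1) b v x → GlobalPos P F h c u x →
    Fluent.on b (.inl c) u v ∈ F
  surface : ∀ b s u v, 1 ≤ u → u ≤ P.size (.inr s) → GlobalPos P F 1 b v (P.offset s + u) →
    Fluent.on b (.inr s) u v ∈ F

/-- Existence and uniqueness of the positions of blocks and of their unit spaces. -/
structure ValidState (P : Problem A B S) (F : Set (Fluent A B S)) : Prop where
  gripper_unique : ∀ a b b', Fluent.holding a b ∈ F → Fluent.holding a b' ∈ F → b = b'
  holder_unique : ∀ a a' b, Fluent.holding a b ∈ F → Fluent.holding a' b ∈ F → a = a'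
  held_not_on : ∀ a b l, Fluent.holding a b ∈ F → ¬ RestsOn F b l
  below_unique : ∀ b v l u l' u', Fluent.on b l u v ∈ F → Fluent.on b l' u' v ∈ F →
    l = l' ∧ u = u'
  above_unique : ∀ l u b v b' v', Fluent.on b l u v ∈ F → Fluent.on b' l u v' ∈ F →
    b = b' ∧ v = v'
  located : ∀ b, (∃ a, Fluent.holding a b ∈ F) ∨ ∃ l, RestsOn F b l
  pos_unique : ∀ b v h x h' x', GlobalPos P F h b v x → GlobalPos P F h' b v x' →
    h = h' ∧ x = x'
  no_overlap : ∀ h x b v b' v', GlobalPos P F h b v x → GlobalPos P F h b' v' x →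
    b = b' ∧ v = v'
  not_carried_and_grounded : ∀ b, Carried F b → ¬ Grounded F b

/-- No block is supported by itself. -/
def NoCircularSupport (F : Set (Fluent A B S)) : Prop :=
  ∀ b, ¬ Supported F b (.inl b)

end States

/-! ### Structures submitted to the stability check -/

/-- A structure of blocks: which blocks are held by which grippers, and the contacts
`(b, l, u, v)` (unit `v` of block `b` is on unit `u` of `l`). -/
structure Assembly (A B S : Type*) where
  held : Set (A × B)
  contacts : Set (B × (B ⊕ S) × ℕ × ℕ)

/-- The structure formed by the blocks that are supported by the ground. -/
def groundAssembly {A B S : Type*} (F : Set (Fluent A B S)) : Assembly A B S where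
  held := ∅
  contacts := {c | Fluent.on c.1 c.2.1 c.2.2.1 c.2.2.2 ∈ F ∧ Grounded F c.1}

/-- The structure formed by the blocks that are carried by the grippers. -/
def carriedAssembly {A B S : Type*} (F : Set (Fluent A B S)) : Assembly A B S where
  held := {p | Fluent.holding p.1 p.2 ∈ F}
  contacts := {c | Fluent.on c.1 c.2.1 c.2.2.1 c.2.2.2 ∈ F ∧ Carried F c.1}

/-! ### Robot construction plans -/

/-- What one gripper does at one step: pick the block `b`, or place the held block `b` so that its
unit `v` comes on the unit `u` of `l`. -/
inductive Act (B S : Type*) where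
  | pick (b : B)
  | place (b : B) (l : B ⊕ S) (u v : ℕ)

section Plans

variable {A B S : Type*}

/-- The action `x` of the gripper `a` is executable in the state `F`. -/
def Executable (P : Problem A B S) (F : Set (Fluent A B S)) (a : A) : Act B S → Prop
  | .pick b => (∀ c, Fluent.holding a c ∉ F) ∧ ∀ a', Fluent.holding a' b ∉ F
  | .place b l u v => Fluent.holding a b ∈ F ∧ (1 ≤ u ∧ u ≤ P.size l) ∧
      (1 ≤ v ∧ v ≤ P.size (.inl b))

/-- The block `b` is picked by some gripper. -/
def Picked (e : A → Option (Act B S)) (b : B) : Prop :=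
  ∃ a, e a = some (.pick b)

/-- The block `b` is picked, or it is supported by a picked block and thus moves along. -/
def Moved (F : Set (Fluent A B S)) (e : A → Option (Act B S)) (b : B) : Prop :=
  ∃ c, Picked e c ∧ (b = c ∨ Supported F b (.inl c))

/-- Performing concurrently the actions `e a` of the grippers in the state `F` leads to `F'`. -/
structure Step (P : Problem A B S) (F : Set (Fluent A B S)) (e : A → Option (Act B S))
    (F' : Set (Fluent A B S)) : Prop where
  executable : ∀ a x, e a = some x → Executable P F a x
  /-- After the step a gripper holds exactly what it picked, or what it held and did not place. -/
  holding_iff : ∀ a b, Fluent.holding a b ∈ F' ↔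
    e a = some (.pick b) ∨ (Fluent.holding a b ∈ F ∧ ∀ c l u v, e a ≠ some (.place c l u v))
  /-- Placing a block establishes the intended contact. -/
  placed : ∀ a b l u v, e a = some (.place b l u v) → Fluent.on b l u v ∈ F'
  /-- Inertia: a contact of a block that does not move persists. -/
  persist : ∀ b l u v, Fluent.on b l u v ∈ F → ¬ Moved F e b → Fluent.on b l u v ∈ F'
  /-- Inertia: a block that is not picked itself moves along with the moving blocks it is on. -/
  persist_moved : ∀ b c u v, Fluent.on b (.inl c) u v ∈ F → Moved F e c → ¬ Picked e b →
    Fluent.on b (.inl c) u v ∈ F'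
  /-- Inertia: the contacts after the step are those that persist, those established by placing,
  and those that follow from these by ramification; there are no others. -/
  caused : ∀ R : Set (Fluent A B S), RamificationClosed P R →
    (∀ b l u v, Fluent.on b l u v ∈ F → Fluent.on b l u v ∈ F' → Fluent.on b l u v ∈ R) →
    (∀ a b l u v, e a = some (.place b l u v) → Fluent.on b l u v ∈ R) →
    ∀ b l u v, Fluent.on b l u v ∈ F' → Fluent.on b l u v ∈ R

/-- The data of a plan: the states at times `0, …, makespan` and the concurrent actions of the
grippers at times `0, …, makespan - 1` (values at later times are irrelevant). -/
structure Plan (A B S : Type*) where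
  makespan : ℕ
  state : ℕ → Set (Fluent A B S)
  act : ℕ → A → Option (Act B S)

/-- `p` is a robot construction plan for `P`: it leads from the initial state through states in
which blocks have unique positions to a state satisfying the goal conditions, and the ramifications
are respected. -/
structure IsConstructionPlan (P : Problem A B S) (p : Plan A B S) : Prop where
  init : p.state 0 = P.init
  valid : ∀ t ≤ p.makespan, ValidState P (p.state t)
  ramification : ∀ t ≤ p.makespan, RamificationClosed P (p.state t)
  step : ∀ t < p.makespan, Step P (p.state t) (p.act t) (p.state (t + 1))
  goal : ∀ g ∈ P.goal, ¬ ((∀ f ∈ g.1, f ∈ p.state p.makespan) ∧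
    ∀ f ∈ g.2, f ∉ p.state p.makespan)

/-- At each time there is no circular configuration of blocks. -/
def IsSupportedPlan (p : Plan A B S) : Prop :=
  ∀ t ≤ p.makespan, NoCircularSupport (p.state t)

/-- At each time the structure on the ground is stable, and so is what the grippers carry whenever
some held block has another block on it. -/
def IsStablePlan (Stable : Assembly A B S → Prop) (p : Plan A B S) : Prop :=
  ∀ t ≤ p.makespan, Stable (groundAssembly (p.state t)) ∧
    ((∃ a b c, Fluent.holding a b ∈ p.state t ∧ RestsOn (p.state t) c (.inl b)) →
      Stable (carriedAssembly (p.state t)))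

/-- For a bridge: in the end, a block on the ground of the left side is connected to a block on
the ground of the right side. -/
def IsConnectedPlan (P : Problem A B S) (p : Plan A B S) : Prop :=
  ∀ region ∈ P.bridge, ∃ x y, Connected (p.state p.makespan) x y ∧
    (∃ s u v, (s, u) ∈ region .left ∧ Fluent.on x (.inr s) u v ∈ p.state p.makespan) ∧
    (∃ s u v, (s, u) ∈ region .right ∧ Fluent.on y (.inr s) u v ∈ p.state p.makespan)

end Plans

/-! ### The program -/

/-- The atoms of the program. The last argument `t` is the time step. The atom `compl p` stands
for the complement of `p`; it occurs only in rules `p ∨ compl p ← …` that express the choice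
`{p} ← …`. -/
inductive Atom (A B S : Type*) where
  | fluent (f : Fluent A B S) (t : ℕ)
  | pick (a : A) (b : B) (t : ℕ)
  | place (a : A) (l : B ⊕ S) (t : ℕ)
  | placeOn (a : A) (b : B) (l : B ⊕ S) (u v : ℕ) (t : ℕ)
  | moved (b : B) (t : ℕ)
  | onAux (b : B) (l : B ⊕ S) (t : ℕ)
  | supported (b : B) (l : B ⊕ S) (t : ℕ)
  | above (h : ℕ) (b : B) (v : ℕ) (x : ℤ) (t : ℕ)
  | connected (x y : B) (t : ℕ)
  | side (x : B) (σ : Side) (t : ℕ)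
  | compl (p : Atom A B S)

section Program

variable {A B S : Type*}

/-- The atom `holding(a, b, t)`. -/
def holdingA (a : A) (b : B) (t : ℕ) : Atom A B S := .fluent (.holding a b) t

/-- The atom `on(b, l, u, v, t)`. -/
def onA (b : B) (l : B ⊕ S) (u v t : ℕ) : Atom A B S := .fluent (.on b l u v) t

/-- The state at time `t` described by an interpretation. -/
def fluentsAt (I : Set (Atom A B S)) (t : ℕ) : Set (Fluent A B S) :=
  {f | Atom.fluent f t ∈ I}

/-- The rule `⋁ head ← pos, not neg` with ordinary atoms only. -/
def plainRule (head pos neg : List (Atom A B S)) : Rule (Atom A B S) :=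
  ⟨head, pos.map .atom, neg.map .atom⟩

/-- The basic program: initial state and goal, choice, preconditions and effects of actions,
inertia, and existence and uniqueness constraints for positions. -/
inductive BasicRule (P : Problem A B S) (T : ℕ) : Rule (Atom A B S) → Prop
  -- the problem instance
  | init (f : Fluent A B S) : f ∈ P.init → BasicRule P T (plainRule [.fluent f 0] [] [])
  | goal (g : List (Fluent A B S) × List (Fluent A B S)) : g ∈ P.goal →
      BasicRule P T (plainRule [] (g.1.map (.fluent · T)) (g.2.map (.fluent · T)))
  -- actions are chosen freely
  | pick_choice (a : A) (b : B) (t : ℕ) : t < T →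
      BasicRule P T (plainRule [.pick a b t, .compl (.pick a b t)] [] [])
  | place_choice (a : A) (l : B ⊕ S) (t : ℕ) : t < T →
      BasicRule P T (plainRule [.place a l t, .compl (.place a l t)] [] [])
  | placeOn_choice (a : A) (b : B) (l : B ⊕ S) (u v t : ℕ) : t < T →
      1 ≤ u → u ≤ P.size l → 1 ≤ v → v ≤ P.size (.inl b) →
      BasicRule P T (plainRule [.placeOn a b l u v t, .compl (.placeOn a b l u v t)]
        [.place a l t, holdingA a b t] [])
  -- each action of placing has exactly one attribute, each gripper places at one location
  | placeOn_unique (a : A) (l : B ⊕ S) (t : ℕ) : t < T →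
      BasicRule P T ⟨[], [.atom (.place a l t),
        .count (fun i : B × ℕ × ℕ => [.placeOn a i.1 l i.2.1 i.2.2 t]) (· ≠ 1)], []⟩
  | place_unique (a : A) (l l' : B ⊕ S) (t : ℕ) : t < T → l ≠ l' →
      BasicRule P T (plainRule [] [.place a l t, .place a l' t] [])
  -- preconditions
  | pick_pre_gripper (a : A) (b c : B) (t : ℕ) : t < T →
      BasicRule P T (plainRule [] [.pick a b t, holdingA a c t] [])
  | pick_pre_block (a a' : A) (b : B) (t : ℕ) : t < T →
      BasicRule P T (plainRule [] [.pick a b t, holdingA a' b t] [])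
  | place_pre (a : A) (l : B ⊕ S) (t : ℕ) : t < T →
      BasicRule P T ⟨[], [.atom (.place a l t),
        .count (fun b : B => [holdingA a b t]) (· = 0)], []⟩
  -- effects
  | pick_effect (a : A) (b : B) (t : ℕ) : t < T →
      BasicRule P T (plainRule [holdingA a b (t + 1)] [.pick a b t] [])
  | place_effect (a : A) (b : B) (l : B ⊕ S) (u v t : ℕ) : t < T →
      BasicRule P T (plainRule [onA b l u v (t + 1)] [.placeOn a b l u v t] [])
  | place_empties (a : A) (b : B) (l : B ⊕ S) (t : ℕ) : t < T →
      BasicRule P T (plainRule [] [.place a l t, holdingA a b (t + 1)] [])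
  -- inertia
  | inertia (f : Fluent A B S) (t : ℕ) : t < T →
      BasicRule P T (plainRule [.fluent f (t + 1), .compl (.fluent f (t + 1))] [.fluent f t] [])
  | moved_pick (a : A) (b : B) (t : ℕ) : t < T →
      BasicRule P T (plainRule [.moved b t] [.pick a b t] [])
  | moved_on (b c : B) (u v t : ℕ) : t < T →
      BasicRule P T (plainRule [.moved b t] [onA b (.inl c) u v t, .moved c t] [])
  | no_loss (b : B) (l : B ⊕ S) (u v t : ℕ) : t < T →
      BasicRule P T (plainRule [] [onA b l u v t] [onA b l u v (t + 1), .moved b t])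
  | no_loss_moved (b c : B) (u v t : ℕ) : t < T →
      BasicRule P T ⟨[], [.atom (onA b (.inl c) u v t), .atom (.moved c t),
        .count (fun a : A => [.pick a b t]) (· = 0)], [.atom (onA b (.inl c) u v (t + 1))]⟩
  -- existence and uniqueness of positions
  | gripper_unique (a : A) (b b' : B) (t : ℕ) : t ≤ T → b ≠ b' →
      BasicRule P T (plainRule [] [holdingA a b t, holdingA a b' t] [])
  | holder_unique (a a' : A) (b : B) (t : ℕ) : t ≤ T → a ≠ a' →
      BasicRule P T (plainRule [] [holdingA a b t, holdingA a' b t] [])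
  | held_not_on (a : A) (b : B) (l : B ⊕ S) (u v t : ℕ) : t ≤ T →
      BasicRule P T (plainRule [] [holdingA a b t, onA b l u v t] [])
  | below_unique (b : B) (l l' : B ⊕ S) (u u' v t : ℕ) : t ≤ T → (l, u) ≠ (l', u') →
      BasicRule P T (plainRule [] [onA b l u v t, onA b l' u' v t] [])
  | above_unique (b b' : B) (l : B ⊕ S) (u v v' t : ℕ) : t ≤ T → (b, v) ≠ (b', v') →
      BasicRule P T (plainRule [] [onA b l u v t, onA b' l u v' t] [])
  | located (b : B) (t : ℕ) : t ≤ T →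
      BasicRule P T ⟨[], [.count (fun a : A => [holdingA a b t]) (· = 0),
        .count (fun i : (B ⊕ S) × ℕ × ℕ => [onA b i.1 i.2.1 i.2.2 t]) (· = 0)], []⟩
  | pos_unique (b : B) (v h h' : ℕ) (x x' : ℤ) (t : ℕ) : t ≤ T → (h, x) ≠ (h', x') →
      BasicRule P T (plainRule [] [.above h b v x t, .above h' b v x' t] [])
  | no_overlap (h : ℕ) (x : ℤ) (b b' : B) (v v' t : ℕ) : t ≤ T → (b, v) ≠ (b', v') →
      BasicRule P T (plainRule [] [.above h b v x t, .above h b' v' x t] [])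
  | not_carried_and_grounded (a : A) (b c : B) (s : S) (t : ℕ) : t ≤ T →
      BasicRule P T (plainRule []
        [.supported b (.inr s) t, .supported b (.inl c) t, holdingA a c t] [])

/-- Definition of supportedness, and the supportedness constraints. -/
inductive SupportRule (T : ℕ) : Rule (Atom A B S) → Prop
  | onAux (b : B) (l : B ⊕ S) (u v t : ℕ) : t ≤ T →
      SupportRule T (plainRule [.onAux b l t] [onA b l u v t] [])
  | base (b : B) (l : B ⊕ S) (t : ℕ) : t ≤ T →
      SupportRule T (plainRule [.supported b l t] [.onAux b l t] [])
  | trans (b c : B) (l : B ⊕ S) (t : ℕ) : t ≤ T → b ≠ c →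
      SupportRule T (plainRule [.supported b l t] [.onAux b (.inl c) t, .supported c l t] [])
  | irrefl (b : B) (t : ℕ) : t ≤ T →
      SupportRule T (plainRule [] [.supported b (.inl b) t] [])

/-- Definition of global positions, and the ramification rules. -/
inductive RamificationRule (P : Problem A B S) (T : ℕ) : Rule (Atom A B S) → Prop
  | right (b : B) (l : B ⊕ S) (u v i t : ℕ) : t ≤ T → 1 ≤ i →
      v + i ≤ P.size (.inl b) → u + i ≤ P.size l →
      RamificationRule P T (plainRule [onA b l (u + i) (v + i) t] [onA b l u v t] [])
  | left (b : B) (l : B ⊕ S) (u v j t : ℕ) : t ≤ T → 1 ≤ j → 1 ≤ v → 1 ≤ u →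
      RamificationRule P T (plainRule [onA b l u v t] [onA b l (u + j) (v + j) t] [])
  | above_ground (b : B) (s : S) (u v t : ℕ) : t ≤ T →
      RamificationRule P T (plainRule [.above 1 b v (P.offset s + u) t] [onA b (.inr s) u v t] [])
  | above_up (h : ℕ) (b c : B) (u v : ℕ) (x : ℤ) (t : ℕ) : t ≤ T →
      RamificationRule P T (plainRule [.above (h + 1) b v x t]
        [.above h c u x t, onA b (.inl c) u v t] [])
  | above_right (h : ℕ) (b : B) (v : ℕ) (x : ℤ) (t : ℕ) : t ≤ T → v < P.size (.inl b) →
      RamificationRule P T (plainRule [.above h b (v + 1) (x + 1) t] [.above h b v x t] [])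
  | above_left (h : ℕ) (b : B) (v : ℕ) (x : ℤ) (t : ℕ) : t ≤ T → 1 < v →
      RamificationRule P T (plainRule [.above h b (v - 1) (x - 1) t] [.above h b v x t] [])
  | beneath (h : ℕ) (b c : B) (u v : ℕ) (x : ℤ) (t : ℕ) : t ≤ T →
      RamificationRule P T (plainRule [onA b (.inl c) u v t]
        [.above (h + 1) b v x t, .above h c u x t] [])
  | surface (b : B) (s : S) (u v t : ℕ) : t ≤ T → 1 ≤ u → u ≤ P.size (.inr s) →
      RamificationRule P T (plainRule [onA b (.inr s) u v t] [.above 1 b v (P.offset s + u) t] [])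

/-- The external atom `&stable[on, t]()`. -/
def stableAtom (Γ : Assembly A B S → Bool) (t : ℕ) : BodyAtom (Atom A B S) :=
  .ext fun I => Γ (groundAssembly (fluentsAt I t)) = true

/-- The external atom `&hStable[holding, on, t]()`. -/
def hStableAtom (Γ : Assembly A B S → Bool) (t : ℕ) : BodyAtom (Atom A B S) :=
  .ext fun I => Γ (carriedAssembly (fluentsAt I t)) = true

/-- The stability constraints. -/
inductive StabilityRule (Γ : Assembly A B S → Bool) (T : ℕ) : Rule (Atom A B S) → Prop
  | ground (t : ℕ) : t ≤ T → StabilityRule Γ T ⟨[], [], [stableAtom Γ t]⟩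
  | carried (a : A) (b c : B) (t : ℕ) : t ≤ T →
      StabilityRule Γ T ⟨[], [.atom (holdingA a b t), .atom (.onAux c (.inl b) t)],
        [hStableAtom Γ t]⟩

/-- For bridges (and only for them): definition of connectedness and of the sides, and the
connectedness constraint. -/
inductive ConnectedRule (P : Problem A B S) (T : ℕ) : Rule (Atom A B S) → Prop
  | down (region : Side → Set (S × ℕ)) (x y : B) (t : ℕ) : region ∈ P.bridge → t ≤ T →
      ConnectedRule P T (plainRule [.connected x y t] [.onAux x (.inl y) t] [])
  | up (region : Side → Set (S × ℕ)) (x y : B) (t : ℕ) : region ∈ P.bridge → t ≤ T →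
      ConnectedRule P T (plainRule [.connected x y t] [.onAux y (.inl x) t] [])
  | trans (region : Side → Set (S × ℕ)) (x y z : B) (t : ℕ) : region ∈ P.bridge → t ≤ T →
      ConnectedRule P T (plainRule [.connected x z t] [.connected x y t, .connected y z t] [])
  | side (region : Side → Set (S × ℕ)) (σ : Side) (x : B) (s : S) (u v t : ℕ) :
      region ∈ P.bridge → t ≤ T → (s, u) ∈ region σ →
      ConnectedRule P T (plainRule [.side x σ t] [onA x (.inr s) u v t] [])
  | goal (region : Side → Set (S × ℕ)) : region ∈ P.bridge →
      ConnectedRule P T ⟨[], [.count (fun i : B × B =>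
        [.connected i.1 i.2 T, .side i.1 .left T, .side i.2 .right T]) (· = 0)], []⟩

/-- The construction program extended with the supportedness, stability and (for bridges)
connectedness constraints and the ramification rules. -/
def constructionProgram (P : Problem A B S) (Γ : Assembly A B S → Bool) (T : ℕ) :
    Set (Rule (Atom A B S)) :=
  {r | BasicRule P T r ∨ SupportRule T r ∨ RamificationRule P T r ∨ StabilityRule Γ T r ∨
    ConnectedRule P T r}

/-- The interpretation `I` describes the plan `p` over the time steps `0, …, T`: its action atoms
are exactly those of `p` (nothing is done from step `makespan` on), and at every time its fluents
are exactly those of the current state of `p`, the last state persisting until `T`. -/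
structure Characterizes (T : ℕ) (I : Set (Atom A B S)) (p : Plan A B S) : Prop where
  fluents : ∀ t ≤ T, fluentsAt I t = p.state (min t p.makespan)
  pick_iff : ∀ a b t, Atom.pick a b t ∈ I ↔ t < p.makespan ∧ p.act t a = some (.pick b)
  place_iff : ∀ a l t, Atom.place a l t ∈ I ↔
    t < p.makespan ∧ ∃ b u v, p.act t a = some (.place b l u v)
  placeOn_iff : ∀ a b l u v t, Atom.placeOn a b l u v t ∈ I ↔
    t < p.makespan ∧ p.act t a = some (.place b l u v)

end Program

/-! ### Rules with ordinary atoms and positive bodies -/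

/-! The plan, continued by idling up to time `T`, is turned into an interpretation `I`
(`planInterpretation`): fluents and actions are read off the plan, every defined predicate gets its
intended meaning, and `compl q` is true exactly when the choice of `q` is offered and declined.

That `I` is a model is a comparison of rules with definitions. Constraints are contrapositives of
clauses in the definition of a plan or of the desired properties, derivation rules are closure
properties of the relations that interpret their heads, and choices hold by excluded middle.

The substance is minimality. Let `J ⊆ I` be a model of the reduct. Every rule with a nonempty head
has a positive body of ordinary atoms, so if its body holds in `J`, it holds in `I` and the rule is
in the reduct; external atoms and counts occur only in constraints and play no role here. In an
offered choice, the disjunct that is false in `I` is absent from `J`, so `J` contains the other one.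
Hence `J` makes the same choices as the plan. Induction on time (`stateAt_subset_fluentsAt`) then
yields the fluents: the contacts of `J` at a given time are ramification closed
(`ramificationClosed_fluentsAt`) and contain the persisting and the placed ones, so the clause
`Step.caused` puts all contacts of the plan among them. The remaining predicates are inductively
generated by their rules, so their atoms follow by induction on derivations. -/

theorem plainRule_bodyHolds_iff {A B S : Type*} {head pos neg : List (Atom A B S)}
    {I : Set (Atom A B S)} :
    (plainRule head pos neg).BodyHolds I ↔ (∀ q ∈ pos, q ∈ I) ∧ ∀ q ∈ neg, q ∉ I := by
  simp [plainRule, Rule.BodyHolds, BodyAtom.Holds]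

theorem BodyAtom.not_holds_count_eq_zero_iff {α ι : Type*} {cond : ι → List α} {I : Set α} :
    ¬ (BodyAtom.count cond (· = 0)).Holds I ↔ ∃ i, ∀ q ∈ cond i, q ∈ I := by
  simp [BodyAtom.count, BodyAtom.Holds, Set.eq_empty_iff_forall_notMem]

/-- A model of the reduct with respect to a larger interpretation satisfies the positive rules of
the program. -/
theorem IsModel.exists_mem_head_of_reduct {A B S : Type*} {prog : Set (Rule (Atom A B S))}
    {I J : Set (Atom A B S)} (hJ : IsModel (reduct prog I) J) (hJI : J ⊆ I)
    {head pos : List (Atom A B S)} (hr : plainRule head pos [] ∈ prog)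
    (hpos : ∀ q ∈ pos, q ∈ J) : ∃ q ∈ head, q ∈ J :=
  hJ _ ⟨hr, plainRule_bodyHolds_iff.2 ⟨fun q hq => hJI (hpos q hq), by simp⟩⟩
    (plainRule_bodyHolds_iff.2 ⟨hpos, by simp⟩)

theorem IsModel.mem_of_reduct {A B S : Type*} {prog : Set (Rule (Atom A B S))}
    {I J : Set (Atom A B S)} (hJ : IsModel (reduct prog I) J) (hJI : J ⊆ I)
    {q : Atom A B S} {pos : List (Atom A B S)} (hr : plainRule [q] pos [] ∈ prog)
    (hpos : ∀ q ∈ pos, q ∈ J) : q ∈ J := by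
  simpa using hJ.exists_mem_head_of_reduct hJI hr hpos

theorem IsModel.mem_of_reduct_choice {A B S : Type*} {prog : Set (Rule (Atom A B S))}
    {I J : Set (Atom A B S)} (hJ : IsModel (reduct prog I) J) (hJI : J ⊆ I)
    {q q' : Atom A B S} {pos : List (Atom A B S)} (hr : plainRule [q, q'] pos [] ∈ prog)
    (hpos : ∀ q ∈ pos, q ∈ J) (hq' : q' ∉ I) : q ∈ J := by
  have := hJ.exists_mem_head_of_reduct hJI hr hpos
  simp only [List.mem_cons, List.not_mem_nil, or_false, exists_eq_or_imp, exists_eq_left] at this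
  exact this.resolve_right fun h => hq' (hJI h)

theorem IsModel.compl_mem_of_reduct_choice {A B S : Type*} {prog : Set (Rule (Atom A B S))}
    {I J : Set (Atom A B S)} (hJ : IsModel (reduct prog I) J) (hJI : J ⊆ I)
    {q q' : Atom A B S} {pos : List (Atom A B S)} (hr : plainRule [q, q'] pos [] ∈ prog)
    (hpos : ∀ q ∈ pos, q ∈ J) (hq : q ∉ I) : q' ∈ J := by
  have := hJ.exists_mem_head_of_reduct hJI hr hpos
  simp only [List.mem_cons, List.not_mem_nil, or_false, exists_eq_or_imp, exists_eq_left] at this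
  exact this.resolve_left fun h => hq (hJI h)

/-! ### Plans continued by idling -/

section Idle

variable {A B S : Type*}

/-- The state at time `t`, the last state of the plan persisting forever. -/
def Plan.stateAt (p : Plan A B S) (t : ℕ) : Set (Fluent A B S) :=
  p.state (min t p.makespan)

/-- The actions at time `t`, nothing being done from the makespan on. -/
def Plan.actAt (p : Plan A B S) (t : ℕ) (a : A) : Option (Act B S) :=
  if t < p.makespan then p.act t a else none

theorem Plan.actAt_eq_some_iff {p : Plan A B S} {t : ℕ} {a : A} {x : Act B S} :
    p.actAt t a = some x ↔ t < p.makespan ∧ p.act t a = some x := by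
  unfold Plan.actAt
  split_ifs with h <;> simp [h]

/-- With no action every contact is present before and after, so `caused` imposes nothing. This
allows a plan shorter than `T` to be padded. -/
theorem Step.idle (P : Problem A B S) (F : Set (Fluent A B S)) : Step P F (fun _ => none) F where
  executable := by simp
  holding_iff := by simp
  placed := by simp
  persist := fun _ _ _ _ h _ => h
  persist_moved := fun _ _ _ _ h _ _ => h
  caused := fun _ _ h _ b l u v hF => h b l u v hF hF

theorem IsConstructionPlan.step_stateAt {P : Problem A B S} {p : Plan A B S}
    (hp : IsConstructionPlan P p) (t : ℕ) :
    Step P (p.stateAt t) (p.actAt t) (p.stateAt (t + 1)) := by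
  by_cases h : t < p.makespan
  · have hact : p.actAt t = p.act t := by
      funext a
      simp [Plan.actAt, h]
    rw [hact, Plan.stateAt, Plan.stateAt, min_eq_left h.le, min_eq_left h]
    exact hp.step t h
  · have hact : p.actAt t = fun _ => none := by
      funext a
      simp [Plan.actAt, h]
    rw [hact, Plan.stateAt, Plan.stateAt, min_eq_right (by omega), min_eq_right (by omega)]
    exact Step.idle P _

theorem IsConstructionPlan.valid_stateAt {P : Problem A B S} {p : Plan A B S}
    (hp : IsConstructionPlan P p) (t : ℕ) : ValidState P (p.stateAt t) :=
  hp.valid _ (min_le_right _ _)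

theorem IsConstructionPlan.ramification_stateAt {P : Problem A B S} {p : Plan A B S}
    (hp : IsConstructionPlan P p) (t : ℕ) : RamificationClosed P (p.stateAt t) :=
  hp.ramification _ (min_le_right _ _)

theorem IsSupportedPlan.stateAt {p : Plan A B S} (hp : IsSupportedPlan p) (t : ℕ) :
    NoCircularSupport (p.stateAt t) :=
  hp _ (min_le_right _ _)

theorem IsConstructionPlan.stateAt_zero {P : Problem A B S} {p : Plan A B S}
    (hp : IsConstructionPlan P p) : p.stateAt 0 = P.init := by
  simpa [Plan.stateAt] using hp.init

/-! ### Chains of supports and moved blocks. -/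

theorem Supported.of_restsOn {F : Set (Fluent A B S)} {b : B} {l : B ⊕ S} (h : RestsOn F b l) :
    Supported F b l :=
  .single ⟨b, rfl, h⟩

theorem Supported.head {F : Set (Fluent A B S)} {b c : B} {l : B ⊕ S}
    (h : RestsOn F b (.inl c)) (hc : Supported F c l) : Supported F b l :=
  Relation.TransGen.head ⟨b, rfl, h⟩ hc

/-- Induction along a chain of supports, from its lower end. -/
theorem Supported.head_induction {F : Set (Fluent A B S)} {l : B ⊕ S} {motive : B → Prop}
    (base : ∀ b, RestsOn F b l → motive b)
    (step : ∀ b c, RestsOn F b (.inl c) → motive c → motive b)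
    {b : B} (h : Supported F b l) : motive b := by
  -- The support relation lives on all locations, so the starting point is generalised to a location
  -- `x` and its being a block is kept as an equation.
  have key : ∀ x, Relation.TransGen (fun x y => ∃ c, x = Sum.inl c ∧ RestsOn F c y) x l →
      ∀ b, x = Sum.inl b → motive b := by
    intro x hx
    induction hx using Relation.TransGen.head_induction_on with
    | single h =>
      rintro b rfl
      obtain ⟨c, hc, h⟩ := h
      cases hc
      exact base b h
    | head h htail ih =>
      rintro b rfl
      obtain ⟨c, hc, h⟩ := h
      cases hc
      -- An intermediate location is a block because the chain continues from it, and only blocks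
      -- rest on anything.
      obtain ⟨d, rfl⟩ : ∃ d, _ = Sum.inl d := by
        rcases Relation.TransGen.head'_iff.1 htail with ⟨_, ⟨d, hd, _⟩, _⟩
        exact ⟨d, hd⟩
      exact step b d h (ih d rfl)
  exact key _ h b rfl

theorem Moved.of_on {F : Set (Fluent A B S)} {e : A → Option (Act B S)} {b c : B}
    (h : RestsOn F b (.inl c)) (hc : Moved F e c) : Moved F e b := by
  obtain ⟨d, hd, rfl | hcd⟩ := hc
  · exact ⟨c, hd, .inr (.of_restsOn h)⟩
  · exact ⟨d, hd, .inr (.head h hcd)⟩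

end Idle

/-! ### The intended answer set -/

section Interpretation

variable {A B S : Type*}

/-- The atoms that are true in the interpretation describing the plan `p`. The atom `compl q` is
true if the choice of `q` is offered and `q` is false. -/
def PlanAtom (P : Problem A B S) (T : ℕ) (p : Plan A B S) : Atom A B S → Prop
  -- The bounds on `t` are those of the rules: an atom beyond the horizon has no rule deriving it
  -- and would violate minimality.
  | .fluent f t => t ≤ T ∧ f ∈ p.stateAt t
  | .pick a b t => t < T ∧ p.actAt t a = some (.pick b)
  | .place a l t => t < T ∧ ∃ b u v, p.actAt t a = some (.place b l u v)
  | .placeOn a b l u v t => t < T ∧ p.actAt t a = some (.place b l u v)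
  | .moved b t => t < T ∧ Moved (p.stateAt t) (p.actAt t) b
  | .onAux b l t => t ≤ T ∧ RestsOn (p.stateAt t) b l
  | .supported b l t => t ≤ T ∧ Supported (p.stateAt t) b l
  | .above h b v x t => t ≤ T ∧ GlobalPos P (p.stateAt t) h b v x
  -- For the same reason this predicate is empty unless the problem is a bridge, since its rules
  -- exist only then.
  | .connected x y t => t ≤ T ∧ (∃ region, region ∈ P.bridge) ∧ Connected (p.stateAt t) x y
  | .side x σ t => t ≤ T ∧ ∃ region ∈ P.bridge, ∃ s u v, (s, u) ∈ region σ ∧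
      Fluent.on x (.inr s) u v ∈ p.stateAt t
  | .compl (.pick a b t) => t < T ∧ p.actAt t a ≠ some (.pick b)
  | .compl (.place a l t) => t < T ∧ ¬ ∃ b u v, p.actAt t a = some (.place b l u v)
  -- All conditions but the last say that the choice is offered. The inner quantifiers rebind `b`,
  -- `u`, `v`, because the atom `place` records only the gripper and the location.
  | .compl (.placeOn a b l u v t) => t < T ∧
      ((1 ≤ u ∧ u ≤ P.size l) ∧ 1 ≤ v ∧ v ≤ P.size (.inl b)) ∧
      (∃ b u v, p.actAt t a = some (.place b l u v)) ∧ Fluent.holding a b ∈ p.stateAt t ∧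
      p.actAt t a ≠ some (.place b l u v)
  -- Inertia offers a choice only for a fluent that held one step earlier; at time 0 nothing is
  -- offered, so that case falls under the default `False`.
  | .compl (.fluent f (t + 1)) => t < T ∧ f ∈ p.stateAt t ∧ f ∉ p.stateAt (t + 1)
  | .compl _ => False

/-- The interpretation describing the plan `p`. -/
def planInterpretation (P : Problem A B S) (T : ℕ) (p : Plan A B S) : Set (Atom A B S) :=
  {q | PlanAtom P T p q}

theorem fluentsAt_planInterpretation {P : Problem A B S} {T : ℕ} {p : Plan A B S} {t : ℕ}
    (ht : t ≤ T) : fluentsAt (planInterpretation P T p) t = p.stateAt t :=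
  Set.ext fun _ => and_iff_right ht

theorem characterizes_planInterpretation (P : Problem A B S) {T : ℕ} {p : Plan A B S}
    (hm : p.makespan ≤ T) : Characterizes T (planInterpretation P T p) p where
  fluents _ ht := fluentsAt_planInterpretation ht
  pick_iff a b t := by
    change t < T ∧ p.actAt t a = _ ↔ _
    -- The bound `t < T` is implied by `t < p.makespan`.
    rw [Plan.actAt_eq_some_iff, and_iff_right_of_imp fun h => by omega]
  place_iff a l t := by
    change (t < T ∧ ∃ b u v, p.actAt t a = _) ↔ _
    simp only [Plan.actAt_eq_some_iff, exists_and_left]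
    rw [and_iff_right_of_imp fun h => by omega]
  placeOn_iff a b l u v t := by
    change t < T ∧ p.actAt t a = _ ↔ _
    rw [Plan.actAt_eq_some_iff, and_iff_right_of_imp fun h => by omega]

/-! ### The interpretation is a model -/

theorem planInterpretation_satisfies_basicRule {P : Problem A B S} {T : ℕ} {p : Plan A B S}
    (hp : IsConstructionPlan P p) (hm : p.makespan ≤ T) {r : Rule (Atom A B S)}
    (hr : BasicRule P T r) (hbody : r.BodyHolds (planInterpretation P T p)) :
    ∃ q ∈ r.head, q ∈ planInterpretation P T p := by
  have hstep := hp.step_stateAt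
  have hvalid := hp.valid_stateAt
  cases hr with
  | init f hf =>
    exact ⟨_, List.mem_singleton_self _, Nat.zero_le _, hp.stateAt_zero ▸ hf⟩
  | goal g hg =>
    rw [plainRule_bodyHolds_iff] at hbody
    simp only [List.mem_map, forall_exists_index, and_imp, forall_apply_eq_imp_iff₂] at hbody
    have hT : p.stateAt T = p.state p.makespan := by rw [Plan.stateAt, min_eq_right hm]
    refine absurd ⟨fun f hf => ?_, fun f hf => ?_⟩ (hp.goal g hg)
    · exact hT ▸ (hbody.1 f hf).2
    · exact fun h => hbody.2 f hf ⟨le_rfl, hT ▸ h⟩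
  | pick_choice a b t ht =>
    by_cases h : p.actAt t a = some (.pick b)
    · exact ⟨_, List.mem_cons_self, ht, h⟩
    · exact ⟨_, List.mem_cons_of_mem _ List.mem_cons_self, ht, h⟩
  | place_choice a l t ht =>
    by_cases h : ∃ b u v, p.actAt t a = some (.place b l u v)
    · exact ⟨_, List.mem_cons_self, ht, h⟩
    · exact ⟨_, List.mem_cons_of_mem _ List.mem_cons_self, ht, h⟩
  | placeOn_choice a b l u v t ht hu hu' hv hv' =>
    rw [plainRule_bodyHolds_iff] at hbody
    simp only [List.forall_mem_cons] at hbody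
    by_cases h : p.actAt t a = some (.place b l u v)
    · exact ⟨_, List.mem_cons_self, ht, h⟩
    · exact ⟨_, List.mem_cons_of_mem _ List.mem_cons_self, ht, ⟨⟨hu, hu'⟩, hv, hv'⟩,
        hbody.1.1.2, hbody.1.2.1.2, h⟩
  | placeOn_unique a l t ht =>
    simp only [Rule.BodyHolds, List.forall_mem_cons] at hbody
    obtain ⟨-, b, u, v, h⟩ := hbody.1.1
    -- The count is 1 because a gripper performs at most one action at a time, and that action
    -- determines block and units.
    refine absurd ?_ hbody.1.2.1
    rw [Set.encard_eq_one]
    refine ⟨(b, u, v), Set.ext fun ⟨b', u', v'⟩ => ?_⟩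
    simp only [List.mem_singleton, forall_eq, Set.mem_ofPred_eq, Set.mem_singleton_iff,
      Prod.mk.injEq]
    constructor
    · rintro ⟨-, h'⟩
      simpa [eq_comm, h] using h'
    · rintro ⟨rfl, rfl, rfl⟩
      exact ⟨ht, h⟩
  | place_unique a l l' t ht hl =>
    rw [plainRule_bodyHolds_iff] at hbody
    simp only [List.forall_mem_cons] at hbody
    obtain ⟨⟨⟨-, b, u, v, h⟩, ⟨-, b', u', v', h'⟩, -⟩, -⟩ := hbody
    rw [h] at h'
    cases h'
    exact absurd rfl hl
  | pick_pre_gripper a b c t ht =>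
    rw [plainRule_bodyHolds_iff] at hbody
    simp only [List.forall_mem_cons] at hbody
    exact absurd hbody.1.2.1.2 (((hstep t).executable a _ hbody.1.1.2).1 c)
  | pick_pre_block a a' b t ht =>
    rw [plainRule_bodyHolds_iff] at hbody
    simp only [List.forall_mem_cons] at hbody
    exact absurd hbody.1.2.1.2 (((hstep t).executable a _ hbody.1.1.2).2 a')
  | place_pre a l t ht =>
    simp only [Rule.BodyHolds, List.forall_mem_cons] at hbody
    obtain ⟨-, b, u, v, h⟩ := hbody.1.1
    refine absurd hbody.1.2.1 (BodyAtom.not_holds_count_eq_zero_iff.2 ⟨b, ?_⟩)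
    simp only [List.mem_singleton, forall_eq]
    exact ⟨ht.le, ((hstep t).executable a _ h).1⟩
  | pick_effect a b t ht =>
    rw [plainRule_bodyHolds_iff] at hbody
    simp only [List.forall_mem_cons] at hbody
    exact ⟨_, List.mem_cons_self, ht, ((hstep t).holding_iff a b).2 (.inl hbody.1.1.2)⟩
  | place_effect a b l u v t ht =>
    rw [plainRule_bodyHolds_iff] at hbody
    simp only [List.forall_mem_cons] at hbody
    exact ⟨_, List.mem_cons_self, ht, (hstep t).placed a b l u v hbody.1.1.2⟩
  | place_empties a b l t ht =>
    rw [plainRule_bodyHolds_iff] at hbody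
    simp only [List.forall_mem_cons] at hbody
    obtain ⟨⟨⟨-, c, u, v, h⟩, ⟨-, h'⟩, -⟩, -⟩ := hbody
    rcases ((hstep t).holding_iff a b).1 h' with h' | h'
    · simp [h] at h'
    · exact absurd h (h'.2 c l u v)
  | inertia f t ht =>
    rw [plainRule_bodyHolds_iff] at hbody
    simp only [List.forall_mem_cons] at hbody
    by_cases h : f ∈ p.stateAt (t + 1)
    · exact ⟨_, List.mem_cons_self, ht, h⟩
    · exact ⟨_, List.mem_cons_of_mem _ List.mem_cons_self, ht, hbody.1.1.2, h⟩
  | moved_pick a b t ht =>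
    rw [plainRule_bodyHolds_iff] at hbody
    simp only [List.forall_mem_cons] at hbody
    exact ⟨_, List.mem_cons_self, ht, b, ⟨a, hbody.1.1.2⟩, .inl rfl⟩
  | moved_on b c u v t ht =>
    rw [plainRule_bodyHolds_iff] at hbody
    simp only [List.forall_mem_cons] at hbody
    exact ⟨_, List.mem_cons_self, ht, .of_on ⟨u, v, hbody.1.1.2⟩ hbody.1.2.1.2⟩
  | no_loss b l u v t ht =>
    rw [plainRule_bodyHolds_iff] at hbody
    simp only [List.forall_mem_cons] at hbody
    exact absurd ⟨ht, (hstep t).persist b l u v hbody.1.1.2 fun h => hbody.2.2.1 ⟨ht, h⟩⟩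
      hbody.2.1
  | no_loss_moved b c u v t ht =>
    simp only [Rule.BodyHolds, List.forall_mem_cons] at hbody
    refine absurd ⟨ht, (hstep t).persist_moved b c u v hbody.1.1.2 hbody.1.2.1.2 ?_⟩ hbody.2.1
    rintro ⟨a, ha⟩
    -- The zero count in the body expresses that the block is not picked, so a picking gripper
    -- contradicts it.
    refine absurd hbody.1.2.2.1 (BodyAtom.not_holds_count_eq_zero_iff.2 ⟨a, ?_⟩)
    simp only [List.mem_singleton, forall_eq]
    exact ⟨ht, ha⟩
  | gripper_unique a b b' t ht hb =>
    rw [plainRule_bodyHolds_iff] at hbody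
    simp only [List.forall_mem_cons] at hbody
    exact absurd ((hvalid t).gripper_unique a b b' hbody.1.1.2 hbody.1.2.1.2) hb
  | holder_unique a a' b t ht ha =>
    rw [plainRule_bodyHolds_iff] at hbody
    simp only [List.forall_mem_cons] at hbody
    exact absurd ((hvalid t).holder_unique a a' b hbody.1.1.2 hbody.1.2.1.2) ha
  | held_not_on a b l u v t ht =>
    rw [plainRule_bodyHolds_iff] at hbody
    simp only [List.forall_mem_cons] at hbody
    exact absurd ⟨u, v, hbody.1.2.1.2⟩ ((hvalid t).held_not_on a b l hbody.1.1.2)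
  | below_unique b l l' u u' v t ht hl =>
    rw [plainRule_bodyHolds_iff] at hbody
    simp only [List.forall_mem_cons] at hbody
    exact absurd (Prod.ext_iff.2
      ((hvalid t).below_unique b v l u l' u' hbody.1.1.2 hbody.1.2.1.2)) hl
  | above_unique b b' l u v v' t ht hb =>
    rw [plainRule_bodyHolds_iff] at hbody
    simp only [List.forall_mem_cons] at hbody
    exact absurd (Prod.ext_iff.2
      ((hvalid t).above_unique l u b v b' v' hbody.1.1.2 hbody.1.2.1.2)) hb
  | located b t ht =>
    simp only [Rule.BodyHolds, List.forall_mem_cons] at hbody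
    rcases (hvalid t).located b with ⟨a, h⟩ | ⟨l, u, v, h⟩
    · refine absurd hbody.1.1 (BodyAtom.not_holds_count_eq_zero_iff.2 ⟨a, ?_⟩)
      simp only [List.mem_singleton, forall_eq]
      exact ⟨ht, h⟩
    · refine absurd hbody.1.2.1 (BodyAtom.not_holds_count_eq_zero_iff.2 ⟨(l, u, v), ?_⟩)
      simp only [List.mem_singleton, forall_eq]
      exact ⟨ht, h⟩
  | pos_unique b v h h' x x' t ht hne =>
    rw [plainRule_bodyHolds_iff] at hbody
    simp only [List.forall_mem_cons] at hbody
    exact absurd (Prod.ext_iff.2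
      ((hvalid t).pos_unique b v h x h' x' hbody.1.1.2 hbody.1.2.1.2)) hne
  | no_overlap h x b b' v v' t ht hne =>
    rw [plainRule_bodyHolds_iff] at hbody
    simp only [List.forall_mem_cons] at hbody
    exact absurd (Prod.ext_iff.2
      ((hvalid t).no_overlap h x b v b' v' hbody.1.1.2 hbody.1.2.1.2)) hne
  | not_carried_and_grounded a b c s t ht =>
    rw [plainRule_bodyHolds_iff] at hbody
    simp only [List.forall_mem_cons] at hbody
    -- The rule speaks only of blocks above a held one, hence the second disjunct of `Carried`; a
    -- held block rests on nothing and is never grounded.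
    exact absurd ⟨s, hbody.1.1.2⟩ ((hvalid t).not_carried_and_grounded b
      ⟨a, c, hbody.1.2.2.1.2, .inr hbody.1.2.1.2⟩)

theorem planInterpretation_satisfies_supportRule {P : Problem A B S} {T : ℕ} {p : Plan A B S}
    (hp : IsSupportedPlan p) {r : Rule (Atom A B S)}
    (hr : SupportRule T r) (hbody : r.BodyHolds (planInterpretation P T p)) :
    ∃ q ∈ r.head, q ∈ planInterpretation P T p := by
  cases hr with
  | onAux b l u v t ht =>
    rw [plainRule_bodyHolds_iff] at hbody
    simp only [List.forall_mem_cons] at hbody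
    exact ⟨_, List.mem_cons_self, ht, u, v, hbody.1.1.2⟩
  | base b l t ht =>
    rw [plainRule_bodyHolds_iff] at hbody
    simp only [List.forall_mem_cons] at hbody
    exact ⟨_, List.mem_cons_self, ht, .of_restsOn hbody.1.1.2⟩
  | trans b c l t ht hbc =>
    rw [plainRule_bodyHolds_iff] at hbody
    simp only [List.forall_mem_cons] at hbody
    exact ⟨_, List.mem_cons_self, ht, .head hbody.1.1.2 hbody.1.2.1.2⟩
  | irrefl b t ht =>
    rw [plainRule_bodyHolds_iff] at hbody
    simp only [List.forall_mem_cons] at hbody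
    exact absurd hbody.1.1.2 (hp.stateAt t b)

theorem planInterpretation_satisfies_ramificationRule {P : Problem A B S} {T : ℕ}
    {p : Plan A B S} (hp : IsConstructionPlan P p) {r : Rule (Atom A B S)}
    (hr : RamificationRule P T r) (hbody : r.BodyHolds (planInterpretation P T p)) :
    ∃ q ∈ r.head, q ∈ planInterpretation P T p := by
  have hram := hp.ramification_stateAt
  cases hr with
  | right b l u v i t ht hi hv hu =>
    rw [plainRule_bodyHolds_iff] at hbody
    simp only [List.forall_mem_cons] at hbody
    exact ⟨_, List.mem_cons_self, ht, (hram t).right b l u v i hi hv hu hbody.1.1.2⟩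
  | left b l u v j t ht hj hv hu =>
    rw [plainRule_bodyHolds_iff] at hbody
    simp only [List.forall_mem_cons] at hbody
    exact ⟨_, List.mem_cons_self, ht, (hram t).left b l u v j hj hv hu hbody.1.1.2⟩
  | above_ground b s u v t ht =>
    rw [plainRule_bodyHolds_iff] at hbody
    simp only [List.forall_mem_cons] at hbody
    exact ⟨_, List.mem_cons_self, ht, .ground hbody.1.1.2⟩
  | above_up h b c u v x t ht =>
    rw [plainRule_bodyHolds_iff] at hbody
    simp only [List.forall_mem_cons] at hbody
    exact ⟨_, List.mem_cons_self, ht, .up hbody.1.1.2 hbody.1.2.1.2⟩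
  | above_right h b v x t ht hv =>
    rw [plainRule_bodyHolds_iff] at hbody
    simp only [List.forall_mem_cons] at hbody
    exact ⟨_, List.mem_cons_self, ht, .right hbody.1.1.2 hv⟩
  | above_left h b v x t ht hv =>
    rw [plainRule_bodyHolds_iff] at hbody
    simp only [List.forall_mem_cons] at hbody
    exact ⟨_, List.mem_cons_self, ht, .left hbody.1.1.2 hv⟩
  | beneath h b c u v x t ht =>
    rw [plainRule_bodyHolds_iff] at hbody
    simp only [List.forall_mem_cons] at hbody
    exact ⟨_, List.mem_cons_self, ht,
      (hram t).beneath h b c u v x hbody.1.1.2 hbody.1.2.1.2⟩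
  | surface b s u v t ht hu hu' =>
    rw [plainRule_bodyHolds_iff] at hbody
    simp only [List.forall_mem_cons] at hbody
    exact ⟨_, List.mem_cons_self, ht, (hram t).surface b s u v hu hu' hbody.1.1.2⟩

/-- The external atoms depend only on the fluents at time `t`, which are those of the plan's state,
so the checker is applied to the very structures whose stability the plan guarantees. -/
theorem planInterpretation_satisfies_stabilityRule {P : Problem A B S} {T : ℕ} {p : Plan A B S}
    {Stable : Assembly A B S → Prop} {Γ : Assembly A B S → Bool}
    (hΓ : ∀ c, Γ c = true ↔ Stable c) (hp : IsStablePlan Stable p) {r : Rule (Atom A B S)}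
    (hr : StabilityRule Γ T r) (hbody : r.BodyHolds (planInterpretation P T p)) :
    ∃ q ∈ r.head, q ∈ planInterpretation P T p := by
  cases hr with
  | ground t ht =>
    simp only [Rule.BodyHolds, List.forall_mem_cons] at hbody
    refine absurd ?_ hbody.2.1
    change Γ _ = true
    rw [fluentsAt_planInterpretation ht, hΓ]
    exact (hp _ (min_le_right _ _)).1
  | carried a b c t ht =>
    simp only [Rule.BodyHolds, List.forall_mem_cons] at hbody
    refine absurd ?_ hbody.2.1
    change Γ _ = true
    rw [fluentsAt_planInterpretation ht, hΓ]
    exact (hp _ (min_le_right _ _)).2 ⟨a, b, c, hbody.1.1.2, hbody.1.2.1.2⟩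

theorem planInterpretation_satisfies_connectedRule {P : Problem A B S} {T : ℕ} {p : Plan A B S}
    (hp : IsConnectedPlan P p) (hm : p.makespan ≤ T) {r : Rule (Atom A B S)}
    (hr : ConnectedRule P T r) (hbody : r.BodyHolds (planInterpretation P T p)) :
    ∃ q ∈ r.head, q ∈ planInterpretation P T p := by
  cases hr with
  | down region x y t hreg ht =>
    rw [plainRule_bodyHolds_iff] at hbody
    simp only [List.forall_mem_cons] at hbody
    exact ⟨_, List.mem_cons_self, ht, ⟨region, hreg⟩, .single (.inl hbody.1.1.2)⟩
  | up region x y t hreg ht =>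
    rw [plainRule_bodyHolds_iff] at hbody
    simp only [List.forall_mem_cons] at hbody
    exact ⟨_, List.mem_cons_self, ht, ⟨region, hreg⟩, .single (.inr hbody.1.1.2)⟩
  | trans region x y z t hreg ht =>
    rw [plainRule_bodyHolds_iff] at hbody
    simp only [List.forall_mem_cons] at hbody
    exact ⟨_, List.mem_cons_self, ht, ⟨region, hreg⟩,
      Relation.TransGen.trans hbody.1.1.2.2 hbody.1.2.1.2.2⟩
  | side region σ x s u v t hreg ht hsu =>
    rw [plainRule_bodyHolds_iff] at hbody
    simp only [List.forall_mem_cons] at hbody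
    exact ⟨_, List.mem_cons_self, ht, region, hreg, s, u, v, hsu, hbody.1.1.2⟩
  | goal region hreg =>
    simp only [Rule.BodyHolds, List.forall_mem_cons] at hbody
    have hT : p.stateAt T = p.state p.makespan := by rw [Plan.stateAt, min_eq_right hm]
    obtain ⟨x, y, hxy, ⟨s, u, v, hs, hx⟩, ⟨s', u', v', hs', hy⟩⟩ := hp region hreg
    rw [← hT] at hxy hx hy
    refine absurd hbody.1.1 (BodyAtom.not_holds_count_eq_zero_iff.2 ⟨(x, y), ?_⟩)
    simp only [List.forall_mem_cons]
    exact ⟨⟨le_rfl, ⟨region, hreg⟩, hxy⟩, ⟨le_rfl, region, hreg, s, u, v, hs, hx⟩,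
      ⟨le_rfl, region, hreg, s', u', v', hs', hy⟩, by simp⟩

/-! ### The interpretation is a minimal model of the reduct -/

/-- In a model of the reduct, the atoms `above` contain the global positions determined by the
contacts. -/
theorem above_mem_of_globalPos {P : Problem A B S} {Γ : Assembly A B S → Bool} {T : ℕ}
    {I J : Set (Atom A B S)} (hJ : IsModel (reduct (constructionProgram P Γ T) I) J)
    (hJI : J ⊆ I) {t : ℕ} (ht : t ≤ T) {h : ℕ} {b : B} {v : ℕ} {x : ℤ}
    (hpos : GlobalPos P (fluentsAt J t) h b v x) : Atom.above h b v x t ∈ J := by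
  induction hpos with
  | ground h_on =>
    exact hJ.mem_of_reduct hJI (.inr (.inr (.inl (.above_ground _ _ _ _ _ ht))))
      (List.forall_mem_singleton.2 h_on)
  | up hc h_on ih =>
    exact hJ.mem_of_reduct hJI (.inr (.inr (.inl (.above_up _ _ _ _ _ _ _ ht))))
      (by simpa using ⟨ih, h_on⟩)
  | right hb hv ih =>
    exact hJ.mem_of_reduct hJI (.inr (.inr (.inl (.above_right _ _ _ _ _ ht hv))))
      (by simpa using ih)
  | left hb hv ih =>
    exact hJ.mem_of_reduct hJI (.inr (.inr (.inl (.above_left _ _ _ _ _ ht hv))))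
      (by simpa using ih)

/-- Global positions are computed here from the contacts of `J` itself, not from those of the plan.
Closure is therefore available before the two are known to agree, as the induction on time requires.
-/
theorem ramificationClosed_fluentsAt {P : Problem A B S} {Γ : Assembly A B S → Bool} {T : ℕ}
    {I J : Set (Atom A B S)} (hJ : IsModel (reduct (constructionProgram P Γ T) I) J)
    (hJI : J ⊆ I) {t : ℕ} (ht : t ≤ T) : RamificationClosed P (fluentsAt J t) where
  right b l u v i hi hv hu h :=
    hJ.mem_of_reduct hJI (.inr (.inr (.inl (.right b l u v i t ht hi hv hu))))
      (List.forall_mem_singleton.2 h)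
  left b l u v j hj hv hu h :=
    hJ.mem_of_reduct hJI (.inr (.inr (.inl (.left b l u v j t ht hj hv hu))))
      (List.forall_mem_singleton.2 h)
  beneath h b c u v x hb hc :=
    hJ.mem_of_reduct hJI (.inr (.inr (.inl (.beneath h b c u v x t ht))))
      (by simpa using
        ⟨above_mem_of_globalPos hJ hJI ht hb, above_mem_of_globalPos hJ hJI ht hc⟩)
  surface b s u v hu hu' hb :=
    hJ.mem_of_reduct hJI (.inr (.inr (.inl (.surface b s u v t ht hu hu'))))
      (by simpa using above_mem_of_globalPos hJ hJI ht hb)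

/-! ### Derivation of every atom of the interpretation in a smaller model of the reduct. -/

section Minimal

variable {P : Problem A B S} {Γ : Assembly A B S → Bool} {T : ℕ} {p : Plan A B S}
  {J : Set (Atom A B S)}

theorem pick_mem (hJ : IsModel (reduct (constructionProgram P Γ T) (planInterpretation P T p)) J)
    (hJI : J ⊆ planInterpretation P T p) {a : A} {b : B} {t : ℕ} (ht : t < T)
    (h : p.actAt t a = some (.pick b)) : Atom.pick a b t ∈ J :=
  hJ.mem_of_reduct_choice hJI (.inl (.pick_choice a b t ht)) (by simp) fun h' => h'.2 h

theorem place_mem (hJ : IsModel (reduct (constructionProgram P Γ T) (planInterpretation P T p)) J)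
    (hJI : J ⊆ planInterpretation P T p) {a : A} {l : B ⊕ S} {t : ℕ} (ht : t < T)
    (h : ∃ b u v, p.actAt t a = some (.place b l u v)) : Atom.place a l t ∈ J :=
  hJ.mem_of_reduct_choice hJI (.inl (.place_choice a l t ht)) (by simp) fun h' => h'.2 h

/-- The choice is offered in `J` only once `J` is known to contain the `holding` atom, hence the
assumption on the fluents at time `t`. The ranges of the units come from executability. -/
theorem placeOn_mem (hp : IsConstructionPlan P p)
    (hJ : IsModel (reduct (constructionProgram P Γ T) (planInterpretation P T p)) J)
    (hJI : J ⊆ planInterpretation P T p) {a : A} {b : B} {l : B ⊕ S} {u v t : ℕ} (ht : t < T)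
    (hfl : p.stateAt t ⊆ fluentsAt J t)
    (h : p.actAt t a = some (.place b l u v)) : Atom.placeOn a b l u v t ∈ J := by
  obtain ⟨hhold, hu, hv⟩ := (hp.step_stateAt t).executable a _ h
  refine hJ.mem_of_reduct_choice hJI (.inl (.placeOn_choice a b l u v t ht hu.1 hu.2 hv.1 hv.2))
    ?_ fun h' => h'.2.2.2.2 h
  simp only [List.forall_mem_cons]
  exact ⟨place_mem hJ hJI ht ⟨b, u, v, h⟩, hfl hhold, by simp⟩

theorem fluent_succ_mem_of_persists
    (hJ : IsModel (reduct (constructionProgram P Γ T) (planInterpretation P T p)) J)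
    (hJI : J ⊆ planInterpretation P T p) {f : Fluent A B S} {t : ℕ} (ht : t < T)
    (hfl : p.stateAt t ⊆ fluentsAt J t) (h : f ∈ p.stateAt t) (h' : f ∈ p.stateAt (t + 1)) :
    f ∈ fluentsAt J (t + 1) :=
  hJ.mem_of_reduct_choice hJI (.inl (.inertia f t ht)) (List.forall_mem_singleton.2 (hfl h))
    fun hc => hc.2.2 h'

theorem stateAt_subset_fluentsAt (hp : IsConstructionPlan P p)
    (hJ : IsModel (reduct (constructionProgram P Γ T) (planInterpretation P T p)) J)
    (hJI : J ⊆ planInterpretation P T p) {t : ℕ} (ht : t ≤ T) :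
    p.stateAt t ⊆ fluentsAt J t := by
  induction t with
  | zero =>
    intro f hf
    rw [hp.stateAt_zero] at hf
    exact hJ.mem_of_reduct hJI (.inl (.init f hf)) (by simp)
  | succ t ih =>
    have hfl := ih (by omega)
    have ht' : t < T := ht
    have hstep := hp.step_stateAt t
    rintro (⟨a, b⟩ | ⟨b, l, u, v⟩) hf
    · rcases (hstep.holding_iff a b).1 hf with h | h
      · exact hJ.mem_of_reduct hJI (.inl (.pick_effect a b t ht'))
          (by simpa using pick_mem hJ hJI ht' h)
      · exact fluent_succ_mem_of_persists hJ hJI ht' hfl h.1 hf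
    -- The ramification closed set taken in `caused` is the set of fluents of `J` at time `t + 1`.
    · refine hstep.caused _ (ramificationClosed_fluentsAt hJ hJI ht) ?_ ?_ b l u v hf
      · exact fun b l u v => fluent_succ_mem_of_persists hJ hJI ht' hfl
      · intro a b l u v h
        exact hJ.mem_of_reduct hJI (.inl (.place_effect a b l u v t ht'))
          (by simpa using placeOn_mem hp hJ hJI ht' hfl h)

theorem onAux_mem (hp : IsConstructionPlan P p)
    (hJ : IsModel (reduct (constructionProgram P Γ T) (planInterpretation P T p)) J)
    (hJI : J ⊆ planInterpretation P T p) {b : B} {l : B ⊕ S} {t : ℕ} (ht : t ≤ T)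
    (h : RestsOn (p.stateAt t) b l) : Atom.onAux b l t ∈ J := by
  obtain ⟨u, v, h⟩ := h
  exact hJ.mem_of_reduct hJI (.inr (.inl (.onAux b l u v t ht)))
    (List.forall_mem_singleton.2 (stateAt_subset_fluentsAt hp hJ hJI ht h))

theorem supported_mem (hp : IsConstructionPlan P p) (hsupp : IsSupportedPlan p)
    (hJ : IsModel (reduct (constructionProgram P Γ T) (planInterpretation P T p)) J)
    (hJI : J ⊆ planInterpretation P T p) {b : B} {l : B ⊕ S} {t : ℕ} (ht : t ≤ T)
    (h : Supported (p.stateAt t) b l) : Atom.supported b l t ∈ J := by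
  refine h.head_induction (motive := fun b => Atom.supported b l t ∈ J) (fun b h => ?_)
    fun b c h ih => ?_
  · exact hJ.mem_of_reduct hJI (.inr (.inl (.base b l t ht)))
      (by simpa using onAux_mem hp hJ hJI ht h)
  · have hbc : b ≠ c := by
      rintro rfl
      exact hsupp.stateAt t b (.of_restsOn h)
    exact hJ.mem_of_reduct hJI (.inr (.inl (.trans b c l t ht hbc)))
      (by simpa using ⟨onAux_mem hp hJ hJI ht h, ih⟩)

theorem moved_mem (hp : IsConstructionPlan P p)
    (hJ : IsModel (reduct (constructionProgram P Γ T) (planInterpretation P T p)) J)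
    (hJI : J ⊆ planInterpretation P T p) {b : B} {t : ℕ} (ht : t < T)
    (h : Moved (p.stateAt t) (p.actAt t) b) : Atom.moved b t ∈ J := by
  obtain ⟨c, ⟨a, ha⟩, h⟩ := h
  have hc : Atom.moved c t ∈ J := hJ.mem_of_reduct hJI (.inl (.moved_pick a c t ht))
    (by simpa using pick_mem hJ hJI ht ha)
  have hon : ∀ b d, RestsOn (p.stateAt t) b (.inl d) → Atom.moved d t ∈ J →
      Atom.moved b t ∈ J := by
    rintro b d ⟨u, v, h⟩ hd
    exact hJ.mem_of_reduct hJI (.inl (.moved_on b d u v t ht))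
      (by simpa using ⟨stateAt_subset_fluentsAt hp hJ hJI ht.le h, hd⟩)
  rcases h with rfl | h
  · exact hc
  · exact h.head_induction (fun b h => hon b c h hc) hon

/-- A single touch is covered by one of the two rules for `onAux`, according to which block is on
top; the transitivity rule then extends the chain link by link. -/
theorem connected_mem (hp : IsConstructionPlan P p)
    (hJ : IsModel (reduct (constructionProgram P Γ T) (planInterpretation P T p)) J)
    (hJI : J ⊆ planInterpretation P T p) {x y : B} {t : ℕ} (ht : t ≤ T)
    {region : Side → Set (S × ℕ)} (hreg : region ∈ P.bridge)
    (h : Connected (p.stateAt t) x y) : Atom.connected x y t ∈ J := by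
  have touch : ∀ x y, RestsOn (p.stateAt t) x (.inl y) ∨ RestsOn (p.stateAt t) y (.inl x) →
      Atom.connected x y t ∈ J := by
    rintro x y (h | h)
    · exact hJ.mem_of_reduct hJI (.inr (.inr (.inr (.inr (.down region x y t hreg ht)))))
        (by simpa using onAux_mem hp hJ hJI ht h)
    · exact hJ.mem_of_reduct hJI (.inr (.inr (.inr (.inr (.up region x y t hreg ht)))))
        (by simpa using onAux_mem hp hJ hJI ht h)
  induction h with
  | single h => exact touch _ _ h
  | tail _ h ih =>
    exact hJ.mem_of_reduct hJI (.inr (.inr (.inr (.inr (.trans region _ _ _ t hreg ht)))))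
      (by simpa using ⟨ih, touch _ _ h⟩)

theorem planInterpretation_subset_of_isModel_reduct (hp : IsConstructionPlan P p)
    (hsupp : IsSupportedPlan p)
    (hJ : IsModel (reduct (constructionProgram P Γ T) (planInterpretation P T p)) J)
    (hJI : J ⊆ planInterpretation P T p) : planInterpretation P T p ⊆ J := by
  have hfl : ∀ t ≤ T, p.stateAt t ⊆ fluentsAt J t :=
    fun t ht => stateAt_subset_fluentsAt hp hJ hJI ht
  intro q hq
  cases q with
  | fluent f t => exact hfl t hq.1 hq.2
  | pick a b t => exact pick_mem hJ hJI hq.1 hq.2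
  | place a l t => exact place_mem hJ hJI hq.1 hq.2
  | placeOn a b l u v t => exact placeOn_mem hp hJ hJI hq.1 (hfl t hq.1.le) hq.2
  | moved b t => exact moved_mem hp hJ hJI hq.1 hq.2
  | onAux b l t => exact onAux_mem hp hJ hJI hq.1 hq.2
  | supported b l t => exact supported_mem hp hsupp hJ hJI hq.1 hq.2
  | above h b v x t =>
    refine above_mem_of_globalPos hJ hJI hq.1 ?_
    -- As `J ⊆ I`, the fluents of `J` are exactly those of the plan, so both give the same global
    -- positions.
    rw [← (hfl t hq.1).antisymm fun f hf => (hJI hf).2]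
    exact hq.2
  | connected x y t =>
    obtain ⟨ht, ⟨region, hreg⟩, h⟩ := hq
    exact connected_mem hp hJ hJI ht hreg h
  | side x σ t =>
    obtain ⟨ht, region, hreg, s, u, v, hsu, h⟩ := hq
    exact hJ.mem_of_reduct hJI
      (.inr (.inr (.inr (.inr (.side region σ x s u v t hreg ht hsu)))))
      (List.forall_mem_singleton.2 (hfl t ht h))
  | compl q =>
    cases q with
    | pick a b t =>
      exact hJ.compl_mem_of_reduct_choice hJI (.inl (.pick_choice a b t hq.1)) (by simp)
        fun h => hq.2 h.2
    | place a l t =>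
      exact hJ.compl_mem_of_reduct_choice hJI (.inl (.place_choice a l t hq.1)) (by simp)
        fun h => hq.2 h.2
    | placeOn a b l u v t =>
      obtain ⟨ht, ⟨hu, hv⟩, hplace, hhold, hne⟩ := hq
      refine hJ.compl_mem_of_reduct_choice hJI
        (.inl (.placeOn_choice a b l u v t ht hu.1 hu.2 hv.1 hv.2)) ?_ fun h => hne h.2
      simp only [List.forall_mem_cons]
      exact ⟨place_mem hJ hJI ht hplace, hfl t ht.le hhold, by simp⟩
    | fluent f t =>
      cases t with
      | zero => exact hq.elim
      | succ t =>
        exact hJ.compl_mem_of_reduct_choice hJI (.inl (.inertia f t hq.1))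
          (List.forall_mem_singleton.2 (hfl t hq.1.le hq.2.1)) fun h => hq.2.2 h.2
    | _ => exact hq.elim

end Minimal

end Interpretation

theorem mainTheorem1 {A B S : Type*} (P : Problem A B S)
    (Stable : Assembly A B S → Prop) (Γ : Assembly A B S → Bool)
    (hΓ : ∀ c, Γ c = true ↔ Stable c)
    (T : ℕ) (hT : 1 ≤ T) (p : Plan A B S)
    (hplan : IsConstructionPlan P p)
    (hsupported : IsSupportedPlan p)
    (hstable : IsStablePlan Stable p)
    (hconnected : IsConnectedPlan P p)
    (hmakespan : p.makespan ≤ T - 1) :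
    ∃ I : Set (Atom A B S),
      IsAnswerSet (constructionProgram P Γ T) I ∧ Characterizes T I p := by
  have hm : p.makespan ≤ T := hmakespan.trans (Nat.sub_le T 1)
  refine ⟨planInterpretation P T p, ⟨?_, fun J hJ hJI =>
    planInterpretation_subset_of_isModel_reduct hplan hsupported hJ hJI⟩,
    characterizes_planInterpretation P hm⟩
  -- Only membership in the program matters here: that the body holds in the interpretation is given
  -- again by `hbody`.
  rintro r ⟨hr | hr | hr | hr | hr, -⟩ hbody
  · exact planInterpretation_satisfies_basicRule hplan hm hr hbody
  · exact planInterpretation_satisfies_supportRule hsupported hr hbody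
  · exact planInterpretation_satisfies_ramificationRule hplan hr hbody
  · exact planInterpretation_satisfies_stabilityRule hΓ hstable hr hbody
  · exact planInterpretation_satisfies_connectedRule hconnected hm hr hbody
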